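/- A \emph{Kleene algebra} is a bounded distributive lattice $(A,\wedge,\vee,\neg,0,1)$ with a unary operation $\neg$ such that $\neg\neg x=x$, $x\wedge y=\neg(\neg x\vee\neg y)$ and $x\wedge\neg x\le y\vee\neg y$; let $\mathsf{KA}$ be the variety of Kleene algebras. The equational theory of \emph{$3$-valued Kleene logic} consists of the pairs of terms that take the same value under every valuation in the chain $\{0<a<1\}$ with $\neg 0=1$, $\neg a=a$, $\neg 1=0$. Let $\mathsf V$ be a variety, $\mathbf F(X)$ its free algebra over $X$, and $\mathbf F(z)$ its one-generated free algebra. An algebra in $\mathsf V$ is \emph{exact} if it is isomorphic to a finitely generated subalgebra of a finitely generated free algebra of $\mathsf V$. A \emph{symbolic e-generalization problem} for $\mathsf V$ is a nonempty finite multiset $\{t_1,\dots,t_m\}$ of elements of $\mathbf F(\omega)$; a \emph{solution} is an $s\in\mathbf F(\omega)$ such that for each $k$ there is an endomorphism $\sigma_k$ of $\mathbf F(\omega)$ with $\sigma_k(s)=t_k$. Solutions are preordered by: $s\preceq s'$ iff $\sigma(s')=s$ for some endomorphism $\sigma$. An \emph{algebraic e-generalization problem} is a homomorphism $h:\mathbf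 F(z)\to\prod_{k=1}^m\mathbf E_k$ with $m\ge 1$, each $\mathbf E_k$ a one-generated exact algebra, and each component of $h$ surjective; a \emph{solution} is a homomorphism $g:\mathbf F(z)\to\mathbf P$, with $\mathbf P$ finitely generated and projective in $\mathsf V$, such that $f\circ g=h$ for some homomorphism $f$. Solutions are preordered by: $g\sqsubseteq g'$ iff $g=f\circ g'$ for some homomorphism $f$. A minimal complete set of a poset is an antichain $M$ such that every element lies above some element of $M$. The \emph{type} of a problem is unitary, finitary, infinitary or nullary according to whether the poset of equivalence classes of its solutions has a minimal complete set with exactly one element, with finitely many (more than one) elements, with infinitely many elements, or no minimal complete set. The (symbolic or algebraic) \emph{e-generalization type} of $\mathsf V$ is the worst type of its problems, from best to worst: unitary, finitary, infinitary, nullary. The type of an equational theory is that of the variety it axiomatizes. \textbf{Theorem.} The e-generalization type, symbolic as well as algebraic, of the variety $\mathsf{KA}$ of Kleene algebras and of $3$-valued Kleene logic is unitary. Moreover, for every E-congruence $\theta$ of the one-generated free Kleene algebra $\mathbf F(z)$, i.e. every kernel of an algebraic e-generalization problem for $\mathsf{KA}$, the set of congruences $\pi\subseteq\theta$ of $\mathbf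 F(z)$ with $\mathbf F(z)/\pi$ projective in $\mathsf{KA}$ has a largest element. -/

import Mathlib

open FirstOrder FirstOrder.Language

universe u

/-! ### Algebras, varieties and free algebras

A type of algebras is a first-order language without relation symbols, an algebra is a structure
for it, and a homomorphism is an `L`-homomorphism `A →[L] B`. -/

section Algebras

variable {L : FirstOrder.Language.{0, 0}}

/-- The algebra of terms: the absolutely free algebra over `X`. -/
instance termStructure [L.IsAlgebraic] (X : Type u) : L.Structure (L.Term X) where
  funMap f ts := Term.func f ts
  RelMap r _ := isEmptyElim r

/-- The direct product, with operations defined componentwise. -/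
instance piStructure {ι : Type*} (A : ι → Type u) [∀ i, L.Structure (A i)] :
    L.Structure (∀ i, A i) where
  funMap f x := fun i => Structure.funMap f fun j => x j i
  RelMap r x := ∀ i, Structure.RelMap r fun j => x j i

/-- A congruence: an equivalence relation compatible with all operations. -/
structure Cong (L : FirstOrder.Language.{0, 0}) (A : Type u) [L.Structure A] extends Setoid A where
  compat : ∀ {n : ℕ} (f : L.Functions n) (x y : Fin n → A), (∀ i, r (x i) (y i)) →
    r (Structure.funMap f x) (Structure.funMap f y)

/-- Congruences ordered by inclusion. -/
instance congPartialOrder (A : Type u) [L.Structure A] : PartialOrder (Cong L A) :=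
  PartialOrder.lift Cong.toSetoid fun θ π h => by cases θ; cases π; cases h; rfl

instance congPrestructure [L.IsAlgebraic] {A : Type u} [inst : L.Structure A] (θ : Cong L A) :
    L.Prestructure θ.toSetoid where
  toStructure := inst
  fun_equiv {_} {f} x y h := θ.compat f x y h
  rel_equiv {_} {r} _ _ _ := isEmptyElim r

/-- The quotient algebra `A / θ`; its structure is the instance `quotientStructure`. -/
abbrev Cong.Quot {A : Type u} [L.Structure A] (θ : Cong L A) : Type u :=
  Quotient θ.toSetoid

/-- The kernel of a homomorphism. -/
def Cong.ker {A B : Type*} [L.Structure A] [L.Structure B] (h : A →[L] B) : Cong L A where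
  toSetoid := Setoid.ker h
  compat f x y hxy := by
    change h _ = h _
    rw [Hom.map_fun, Hom.map_fun]
    exact congrArg _ (funext fun i => hxy i)

/-- An equational theory: a set of pairs of terms over countably many variables. -/
abbrev EqTheory (L : FirstOrder.Language.{0, 0}) : Type := Set (L.Term ℕ × L.Term ℕ)

/-- `A` is a model of the theory `T`, that is, `A` belongs to the variety axiomatized by `T`. -/
def IsModel (T : EqTheory L) (A : Type u) [L.Structure A] : Prop :=
  ∀ e ∈ T, ∀ v : ℕ → A, e.1.realize v = e.2.realize v

/-- The congruence on terms over `X` identifying `s` and `t` when the equation `s ≈ t` holds in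
all algebras of the variety axiomatized by `T`. -/
def termCong [L.IsAlgebraic] (T : EqTheory L) (X : Type u) : Cong L (L.Term X) where
  r s t := ∀ (A : Type u) [L.Structure A], IsModel T A → ∀ v : X → A, s.realize v = t.realize v
  iseqv := ⟨fun _ _ _ _ _ => rfl, fun h A _ hA v => (h A hA v).symm,
    fun h h' A _ hA v => (h A hA v).trans (h' A hA v)⟩
  compat f _ _ h A _ hA v :=
    congrArg (Structure.funMap f) (funext fun i => h i A hA v)

/-- The free algebra over `X` in the variety axiomatized by `T`. -/
abbrev FreeAlg [L.IsAlgebraic] (T : EqTheory L) (X : Type u) : Type u := (termCong T X).Quot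

/-- `P` is projective in the variety axiomatized by `T`. -/
def IsProjectiveAlg (T : EqTheory L) (P : Type u) [L.Structure P] : Prop :=
  IsModel T P ∧
    ∀ (A B : Type u) [L.Structure A] [L.Structure B], IsModel T A → IsModel T B →
      ∀ (h : P →[L] B) (g : A →[L] B), Function.Surjective g → ∃ f : P →[L] A, g.comp f = h

/-- `E` is exact: isomorphic to a finitely generated subalgebra of a finitely generated free
algebra. -/
def IsExactAlg [L.IsAlgebraic] (T : EqTheory L) (E : Type u) [L.Structure E] : Prop :=
  ∃ (X : Type u) (_ : Finite X) (S : L.Substructure (FreeAlg T X)),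
    S.FG ∧ Nonempty (E ≃[L] S)

/-- `A` is generated by one element. -/
def IsOneGenerated (L : FirstOrder.Language.{0, 0}) (A : Type u) [L.Structure A] : Prop :=
  ∃ a : A, Substructure.closure L {a} = (⊤ : L.Substructure A)

/-- A congruence of a free algebra is projective if its quotient is. -/
def IsProjectiveCong [L.IsAlgebraic] (T : EqTheory L) {X : Type u}
    (θ : Cong L (FreeAlg T X)) : Prop :=
  IsProjectiveAlg T θ.Quot

end Algebras

/-! ### Generalization types -/

/-- The four possible types. -/
inductive GenType
  | unitary
  | finitary
  | infinitary
  | nullary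

/-- A numerical rank for comparing types: a larger rank is a better type. -/
def GenType.rank : GenType → ℕ
  | .unitary => 3
  | .finitary => 2
  | .infinitary => 1
  | .nullary => 0

/-- The worst-to-best order `nullary < infinitary < finitary < unitary`. -/
instance genTypePartialOrder : PartialOrder GenType :=
  PartialOrder.lift GenType.rank fun a b h => by cases a <;> cases b <;> simp_all [GenType.rank]

/-- Minimal complete sets of a poset. -/
def IsMinimalCompleteSet {P : Type*} [PartialOrder P] (M : Set P) : Prop :=
  (∀ p, ∃ a ∈ M, a ≤ p) ∧ ∀ a ∈ M, ∀ b ∈ M, a ≤ b → a = b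

open Classical in
/-- The type of a poset, by the cardinality of a minimal complete set. -/
noncomputable def posetType (P : Type*) [PartialOrder P] : GenType :=
  if ∃ M : Set P, IsMinimalCompleteSet M ∧ M.encard = 1 then .unitary
  else if ∃ M : Set P, IsMinimalCompleteSet M ∧ M.Finite ∧ 1 < M.encard then .finitary
  else if ∃ M : Set P, IsMinimalCompleteSet M ∧ M.Infinite then .infinitary
  else .nullary

/-- The type of the poset of equivalence classes associated to a preorder. -/
noncomputable def preorderType (P : Type*) [Preorder P] : GenType :=
  posetType (Antisymmetrization P (· ≤ ·))

section Symbolic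

variable {L : FirstOrder.Language.{0, 0}} [L.IsAlgebraic]

/-- Substitutions: endomorphisms of the free algebra over countably many variables. -/
abbrev Substitution (T : EqTheory L) : Type := FreeAlg T ℕ →[L] FreeAlg T ℕ

/-- A symbolic problem: a nonempty finite multiset of terms up to the theory. -/
abbrev SymProblem (T : EqTheory L) : Type := {t : Multiset (FreeAlg T ℕ) // t ≠ 0}

/-- The solutions (generalizers) of a symbolic problem. -/
def SymSolution {T : EqTheory L} (t : SymProblem T) : Type :=
  {s : FreeAlg T ℕ // ∀ a ∈ t.1, ∃ σ : Substitution T, σ s = a}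

/-- `s ≤ s'` if `s` is less general than `s'`. -/
instance symSolutionPreorder {T : EqTheory L} (t : SymProblem T) : Preorder (SymSolution t) where
  le s s' := ∃ σ : Substitution T, σ s'.1 = s.1
  le_refl _ := ⟨Hom.id L _, rfl⟩
  le_trans _ _ _ := fun ⟨σ, h⟩ ⟨τ, h'⟩ => ⟨σ.comp τ, by rw [Hom.comp_apply, h', h]⟩

/-- The symbolic e-generalization type of the variety axiomatized by `T` is `τ`: the worst of the
types of its symbolic problems. -/
def HasSymbolicType (T : EqTheory L) (τ : GenType) : Prop :=
  IsLeast (Set.range fun t : SymProblem T => preorderType (SymSolution t)) τ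

end Symbolic

section Algebraic

variable {L : FirstOrder.Language.{0, 0}} [L.IsAlgebraic]

/-- The one-generated free algebra `F(z)`. -/
abbrev FreeOne (T : EqTheory L) : Type u := FreeAlg T PUnit.{u + 1}

/-- An algebraic problem: a homomorphism from `F(z)` to a product of `m ≥ 1` one-generated exact
algebras whose components are surjective. -/
structure AlgProblem (T : EqTheory L) where
  m : ℕ
  one_le : 1 ≤ m
  E : Fin m → Type u
  [str : ∀ k, L.Structure (E k)]
  exact : ∀ k, IsExactAlg T (E k)
  oneGenerated : ∀ k, IsOneGenerated L (E k)
  h : FreeOne.{u} T →[L] (∀ k, E k)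
  surjective : ∀ k, Function.Surjective fun x => h x k

attribute [instance] AlgProblem.str

/-- A solution of an algebraic problem: a homomorphism `g` from `F(z)` to a finitely generated
projective algebra through which the problem factors. -/
structure AlgSolution {T : EqTheory L} (p : AlgProblem.{u} T) where
  P : Type u
  [str : L.Structure P]
  fg : Structure.FG L P
  projective : IsProjectiveAlg T P
  g : FreeOne.{u} T →[L] P
  factors : ∃ f : P →[L] (∀ k, p.E k), f.comp g = p.h

attribute [instance] AlgSolution.str

/-- `s ≤ s'` if `s` is less general than `s'`. -/
instance algSolutionPreorder {T : EqTheory L} (p : AlgProblem.{u} T) :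
    Preorder (AlgSolution p) where
  le s s' := ∃ f : s'.P →[L] s.P, f.comp s'.g = s.g
  le_refl _ := ⟨Hom.id L _, Hom.id_comp _⟩
  le_trans _ _ _ := fun ⟨f, h⟩ ⟨f', h'⟩ => ⟨f.comp f', by rw [Hom.comp_assoc, h', h]⟩

/-- The algebraic e-generalization type of the variety axiomatized by `T` is `τ`: the worst of
the types of its algebraic problems. -/
def HasAlgebraicType (T : EqTheory L) (τ : GenType) : Prop :=
  IsLeast (Set.range fun p : AlgProblem.{u} T => preorderType (AlgSolution p)) τ

/-- An E-congruence of `F(z)`: the kernel of an algebraic problem. -/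
def IsECong (T : EqTheory L) (θ : Cong L (FreeOne.{u} T)) : Prop :=
  ∃ p : AlgProblem.{u} T, θ = Cong.ker p.h

end Algebraic

/-! ### Kleene algebras and three-valued Kleene logic -/

/-- The operation symbols of Kleene algebras, indexed by their arities. -/
inductive KleeneOp : ℕ → Type
  | bot : KleeneOp 0
  | top : KleeneOp 0
  | neg : KleeneOp 1
  | inf : KleeneOp 2
  | sup : KleeneOp 2

/-- The language `0, 1, ¬, ∧, ∨`. -/
def kleeneLang : FirstOrder.Language.{0, 0} := ⟨KleeneOp, fun _ => Empty⟩

instance kleeneLangIsAlgebraic : kleeneLang.IsAlgebraic :=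
  fun _ => inferInstanceAs (IsEmpty Empty)

namespace KleeneTerm

/-- The constant `0`. -/
def bot {X : Type u} : kleeneLang.Term X := Term.func KleeneOp.bot ![]
/-- The constant `1`. -/
def top {X : Type u} : kleeneLang.Term X := Term.func KleeneOp.top ![]
/-- Negation. -/
def neg {X : Type u} (s : kleeneLang.Term X) : kleeneLang.Term X := Term.func KleeneOp.neg ![s]
/-- Meet. -/
def inf {X : Type u} (s t : kleeneLang.Term X) : kleeneLang.Term X :=
  Term.func KleeneOp.inf ![s, t]
/-- Join. -/
def sup {X : Type u} (s t : kleeneLang.Term X) : kleeneLang.Term X :=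
  Term.func KleeneOp.sup ![s, t]
/-- The variables used in the axioms. -/
def x : kleeneLang.Term ℕ := Term.var 0
/-- The variables used in the axioms. -/
def y : kleeneLang.Term ℕ := Term.var 1
/-- The variables used in the axioms. -/
def z : kleeneLang.Term ℕ := Term.var 2

end KleeneTerm

open KleeneTerm in
/-- Kleene algebras: bounded distributive lattices with a negation satisfying double negation,
the De Morgan identity and the Kleene identity `x ∧ ¬x ≤ y ∨ ¬y`. -/
def kleeneTheory : EqTheory kleeneLang :=
  { (inf x y, inf y x),
    (sup x y, sup y x),
    (inf (inf x y) z, inf x (inf y z)),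
    (sup (sup x y) z, sup x (sup y z)),
    (inf x (sup x y), x),
    (sup x (inf x y), x),
    (inf x (sup y z), sup (inf x y) (inf x z)),
    (sup x bot, x),
    (inf x top, x),
    (neg (neg x), x),
    (inf x y, neg (sup (neg x) (neg y))),
    (inf (inf x (neg x)) (sup y (neg y)), inf x (neg x)) }

/-- The three truth values `0 < a < 1` of Kleene logic. -/
def K₃ : Type := Fin 3

/-- The three-element chain with `¬0 = 1`, `¬a = a`, `¬1 = 0`. -/
instance kThreeStructure : kleeneLang.Structure K₃ where
  funMap {_} f :=
    match f with
    | KleeneOp.bot => fun _ => (0 : Fin 3)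
    | KleeneOp.top => fun _ => (2 : Fin 3)
    | KleeneOp.neg => fun v => Fin.rev (show Fin 3 from v 0)
    | KleeneOp.inf => fun v => @min (Fin 3) _ (show Fin 3 from v 0) (show Fin 3 from v 1)
    | KleeneOp.sup => fun v => @max (Fin 3) _ (show Fin 3 from v 0) (show Fin 3 from v 1)
  RelMap r _ := isEmptyElim r

/-- Logical equivalence of three-valued Kleene logic: two formulas are equivalent when they take
the same truth value under every three-valued valuation. -/
def kleeneLogicTheory : EqTheory kleeneLang :=
  {e | ∀ v : ℕ → K₃, e.1.realize v = e.2.realize v}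

/-! ### Algebras, models and free algebras -/

section Free

universe v w

variable {L : FirstOrder.Language.{0, 0}}

/-! Every Kleene algebra is separated by homomorphisms into the three-element chain `K₃`, so an
element `a` is governed by the set `values a` of truth values it takes there. Homomorphisms can only
shrink this set. For a set `S` of truth values there is a term in one variable, `canonTerm S`, that
acts as the identity on `S`; hence every element with values in `S` is a specialization of it
(`lift_canonTerm`).

Conversely, an element of a free algebra whose values include `S` specializes to `canonTerm S`,
provided `S` contains 0 or 2 (`exists_hom_to_canonTerm`). Terms are monotone for the information
order, so a classical value is attained at a classical valuation, and a term with two different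
values is undetermined where all variables are. Substituting terms in one variable that interpolate
between two classical valuations then gives `canonTerm S`.

Taking for `S` the values of the data of a problem, `canonTerm S` is a least solution: any solution
has values including `S`. Projective algebras reduce to free ones through a section. The
endomorphism `z ↦ canonTerm S` is idempotent, so its kernel is a projective congruence, and
leastness makes it the largest one below the kernel of the problem. -/

/-- An algebra with a jointly injective family of homomorphisms into models is a model. -/
theorem IsModel.of_jointly_injective {T : EqTheory L} {A : Type v} [L.Structure A] {ι : Type*}
    {B : ι → Type w} [∀ i, L.Structure (B i)] (hB : ∀ i, IsModel T (B i))
    (f : ∀ i, A →[L] B i) (hf : ∀ a b, (∀ i, f i a = f i b) → a = b) : IsModel T A := by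
  intro e he v
  refine hf _ _ fun i => ?_
  rw [← HomClass.realize_term, ← HomClass.realize_term]
  exact hB i e he _

/-- A component of a homomorphism into a product. -/
def piEval {ι : Type*} (A : ι → Type u) [∀ i, L.Structure (A i)] (i : ι) :
    (∀ i, A i) →[L] A i where
  toFun x := x i
  map_fun' _ _ := rfl
  map_rel' _ _ h := h i

theorem IsModel.pi {T : EqTheory L} {ι : Type*} {A : ι → Type u} [∀ i, L.Structure (A i)]
    (hA : ∀ i, IsModel T (A i)) : IsModel T (∀ i, A i) :=
  .of_jointly_injective hA (piEval A) fun _ _ h => funext h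

/-- Retracts of projective algebras are projective. -/
theorem IsProjectiveAlg.of_retract {T : EqTheory L} {P Q : Type u} [L.Structure P] [L.Structure Q]
    (hP : IsProjectiveAlg T P) (i : Q →[L] P) (r : P →[L] Q) (h : ∀ q, r (i q) = q) :
    IsProjectiveAlg T Q := by
  refine ⟨.of_jointly_injective (ι := Unit) (fun _ => hP.1) (fun _ => i) fun a b hab => ?_,
    fun A B _ _ hA hB k g hg => ?_⟩
  · rw [← h a, hab (), h]
  · obtain ⟨f, hf⟩ := hP.2 A B hA hB (k.comp r) g hg
    refine ⟨f.comp i, ?_⟩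
    rw [← Hom.comp_assoc, hf]
    ext q
    simp [h]

variable [L.IsAlgebraic] {T : EqTheory L} {X : Type u}

/-- The quotient homomorphism. -/
def Cong.mkHom {A : Type u} [L.Structure A] (θ : Cong L A) : A →[L] θ.Quot where
  toFun a := Quotient.mk _ a
  map_fun' f x := (funMap_quotient_mk' θ.toSetoid f x).symm
  map_rel' r _ _ := isEmptyElim r

theorem Cong.mkHom_surjective {A : Type u} [L.Structure A] (θ : Cong L A) :
    Function.Surjective θ.mkHom := Quotient.exists_rep

theorem Cong.mkHom_eq {A : Type u} [L.Structure A] (θ : Cong L A) {a b : A} :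
    θ.mkHom a = θ.mkHom b ↔ θ.r a b := Quotient.eq

/-- A homomorphism whose kernel contains a congruence factors through the quotient. -/
def Cong.desc {A : Type u} {B : Type v} [L.Structure A] [L.Structure B] (θ : Cong L A)
    (f : A →[L] B) (h : ∀ a b, θ.r a b → f a = f b) : θ.Quot →[L] B where
  toFun := Quotient.lift f h
  map_fun' F x := by
    obtain ⟨y, rfl⟩ : ∃ y : _ → A, x = fun i => θ.mkHom (y i) :=
      ⟨fun i => (x i).out, funext fun i => ((x i).out_eq).symm⟩
    rw [← Function.comp_def, ← Hom.map_fun]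
    exact f.map_fun F y
  map_rel' r _ _ := isEmptyElim r

/-- Evaluation of terms as a homomorphism. -/
def termEval {A : Type v} [L.Structure A] (v : X → A) : L.Term X →[L] A where
  toFun t := t.realize v
  map_fun' _ _ := rfl
  map_rel' r _ _ := isEmptyElim r

/-- The class of a term in the free algebra. -/
abbrev FreeAlg.mk (T : EqTheory L) (t : L.Term X) : FreeAlg T X := (termCong T X).mkHom t

/-- The free generators. -/
abbrev FreeAlg.of (T : EqTheory L) (x : X) : FreeAlg T X := FreeAlg.mk T (Term.var x)

/-- The homomorphism extending a map on the generators. -/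
def FreeAlg.lift {A : Type u} [L.Structure A] (hA : IsModel T A) (v : X → A) :
    FreeAlg T X →[L] A :=
  (termCong T X).desc (termEval v) fun _ _ h => h A hA v

theorem FreeAlg.lift_mk {A : Type u} [L.Structure A] (hA : IsModel T A) (v : X → A)
    (t : L.Term X) : FreeAlg.lift hA v (FreeAlg.mk T t) = t.realize v := rfl

theorem FreeAlg.realize_of (t : L.Term X) : t.realize (FreeAlg.of T) = FreeAlg.mk T t := by
  change t.realize ((termCong T X).mkHom ∘ Term.var) = _
  rw [HomClass.realize_term]
  congr 1
  induction t with
  | var => rfl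
  | func f ts ih => exact congrArg (Term.func f) (funext ih)

theorem FreeAlg.hom_mk {A : Type v} [L.Structure A] (f : FreeAlg T X →[L] A) (t : L.Term X) :
    f (FreeAlg.mk T t) = t.realize fun x => f (FreeAlg.of T x) := by
  rw [← FreeAlg.realize_of, ← HomClass.realize_term]
  rfl

theorem FreeAlg.hom_ext {A : Type v} [L.Structure A] {f g : FreeAlg T X →[L] A}
    (h : ∀ x, f (FreeAlg.of T x) = g (FreeAlg.of T x)) : f = g := by
  ext t
  obtain ⟨t, rfl⟩ := (termCong T X).mkHom_surjective t
  rw [FreeAlg.hom_mk, FreeAlg.hom_mk]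
  exact congrArg t.realize (funext h)

theorem FreeAlg.isModel (T : EqTheory L) (X : Type u) : IsModel T (FreeAlg T X) := by
  intro e he v
  obtain ⟨w, rfl⟩ : ∃ w : ℕ → L.Term X, v = (termCong T X).mkHom ∘ w :=
    ⟨fun i => (v i).out, funext fun i => ((v i).out_eq).symm⟩
  rw [HomClass.realize_term, HomClass.realize_term, Cong.mkHom_eq]
  intro A _ hA u
  change termEval u _ = termEval u _
  rw [← HomClass.realize_term, ← HomClass.realize_term]
  exact hA e he _

theorem FreeAlg.closure_range_of : Substructure.closure L (Set.range (FreeAlg.of T (X := X))) =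
    (⊤ : L.Substructure (FreeAlg T X)) := by
  rw [eq_top_iff]
  intro t _
  obtain ⟨t, rfl⟩ := (termCong T X).mkHom_surjective t
  induction t with
  | var x => exact Substructure.subset_closure ⟨x, rfl⟩
  | func f ts ih =>
    change (termCong T X).mkHom (Structure.funMap f ts) ∈ _
    rw [Hom.map_fun]
    exact (Substructure.closure L _).fun_mem f _ fun i => ih i trivial

theorem FreeAlg.fg [Finite X] : Structure.FG L (FreeAlg T X) :=
  ⟨Substructure.fg_def.2 ⟨_, Set.finite_range _, FreeAlg.closure_range_of⟩⟩

theorem FreeOne.isOneGenerated : IsOneGenerated L (FreeOne.{u} T) :=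
  ⟨FreeAlg.of T PUnit.unit, by rw [← FreeAlg.closure_range_of, Set.range_unique]⟩

theorem FreeAlg.isProjective (T : EqTheory L) (X : Type u) : IsProjectiveAlg T (FreeAlg T X) := by
  refine ⟨FreeAlg.isModel T X, fun A B _ _ hA _ h g hg => ?_⟩
  choose s hs using hg
  exact ⟨FreeAlg.lift hA fun x => s (h (FreeAlg.of T x)), FreeAlg.hom_ext fun x => hs _⟩

/-- A projective algebra is a retract of a free algebra. -/
theorem IsProjectiveAlg.exists_section {P : Type u} [L.Structure P] (hP : IsProjectiveAlg T P) :
    ∃ s : P →[L] FreeAlg T P, ∀ x, FreeAlg.lift hP.1 id (s x) = x := by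
  obtain ⟨s, hs⟩ := hP.2 _ _ (FreeAlg.isModel T P) hP.1 (Hom.id L P) (FreeAlg.lift hP.1 id)
    fun x => ⟨FreeAlg.of T x, rfl⟩
  exact ⟨s, fun x => DFunLike.congr_fun hs x⟩

theorem IsExactAlg.exists_injective {E : Type u} [L.Structure E] (hE : IsExactAlg T E) :
    ∃ (X : Type u) (f : E →[L] FreeAlg T X), Function.Injective f := by
  obtain ⟨X, _, S, -, ⟨e⟩⟩ := hE
  exact ⟨X, S.subtype.toHom.comp e.toHom, S.subtype.injective.comp e.injective⟩

theorem IsExactAlg.isModel {E : Type u} [L.Structure E] (hE : IsExactAlg T E) : IsModel T E := by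
  obtain ⟨X, f, hf⟩ := hE.exists_injective
  exact .of_jointly_injective (ι := Unit) (fun _ => FreeAlg.isModel T X) (fun _ => f)
    fun a b h => hf (h ())

theorem FreeAlg.isExact (T : EqTheory L) (X : Type u) [Finite X] : IsExactAlg T (FreeAlg T X) :=
  ⟨X, ‹_›, ⊤, FreeAlg.fg.out, ⟨Substructure.topEquiv.symm⟩⟩

end Free

/-! ### Generalization types -/

theorem preorderType_eq_unitary {P : Type*} [Preorder P] (a : P) (ha : ∀ b, a ≤ b) :
    preorderType P = .unitary := by
  refine if_pos ⟨{toAntisymmetrization (· ≤ ·) a}, ⟨fun p => ⟨_, rfl, ?_⟩, ?_⟩,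
    Set.encard_singleton _⟩
  · induction p using Quotient.inductionOn with
    | h b => exact ha b
  · rintro _ rfl _ rfl _
    rfl

theorem isLeast_unitary {ι : Type*} [Nonempty ι] {f : ι → GenType} (h : ∀ i, f i = .unitary) :
    IsLeast (Set.range f) .unitary :=
  ⟨⟨Classical.arbitrary ι, h _⟩, by rintro _ ⟨i, rfl⟩; rw [h]⟩

section Solutions

variable {L : FirstOrder.Language.{0, 0}} [L.IsAlgebraic] {T : EqTheory L}

/-- The solution of an algebraic problem given by a projective congruence below its kernel. -/
def AlgSolution.ofCong {p : AlgProblem.{u} T} {π : Cong L (FreeOne.{u} T)}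
    (hπ : IsProjectiveCong T π) (h : π ≤ Cong.ker p.h) : AlgSolution p where
  P := π.Quot
  fg := FreeAlg.fg.map_of_surjective π.mkHom π.mkHom_surjective
  projective := hπ
  g := π.mkHom
  factors := ⟨π.desc p.h fun _ _ hab => h hab, rfl⟩

/-- An idempotent endomorphism of `F(z)` that is a least solution has as its kernel the largest
projective congruence below the kernel of the problem. -/
theorem isGreatest_ker {p : AlgProblem.{u} T} (g : FreeOne.{u} T →[L] FreeOne.{u} T)
    (hg : ∀ x, g (g x) = g x) (hf : ∃ f : FreeOne.{u} T →[L] (∀ k, p.E k), f.comp g = p.h)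
    (hleast : ∀ s : AlgSolution p, ∃ f : s.P →[L] FreeOne.{u} T, f.comp s.g = g) :
    IsGreatest {π | IsProjectiveCong T π ∧ π ≤ Cong.ker p.h} (Cong.ker g) := by
  refine ⟨⟨?_, ?_⟩, ?_⟩
  -- `g` embeds the quotient by its kernel into `F(z)`; idempotence says exactly that projecting
  -- back is a retraction.
  · refine (FreeAlg.isProjective T _).of_retract ((Cong.ker g).desc g fun _ _ h => h)
      (Cong.ker g).mkHom fun q => ?_
    obtain ⟨x, rfl⟩ := (Cong.ker g).mkHom_surjective q
    exact (Cong.mkHom_eq _).2 (hg x)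
  · obtain ⟨f, hf⟩ := hf
    intro a b (h : g a = g b)
    change p.h a = p.h b
    rw [← hf, Hom.comp_apply, h, Hom.comp_apply]
  · rintro π ⟨hπ, hle⟩ a b hab
    obtain ⟨f, hf⟩ := hleast (.ofCong hπ hle)
    change g a = g b
    rw [← hf]
    exact congrArg f ((Cong.mkHom_eq π).2 hab)

instance SymProblem.instNonempty : Nonempty (SymProblem T) :=
  ⟨⟨{FreeAlg.of T 0}, by simp⟩⟩

instance AlgProblem.instNonempty : Nonempty (AlgProblem.{u} T) :=
  ⟨{ m := 1
     one_le := le_rfl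
     E := fun _ => FreeOne.{u} T
     exact := fun _ => FreeAlg.isExact T _
     oneGenerated := fun _ => FreeOne.isOneGenerated
     h := FreeAlg.lift (.pi fun _ => FreeAlg.isModel T _) fun _ _ => FreeAlg.of T PUnit.unit
     surjective := fun k => by
      have : (piEval (fun _ : Fin 1 => FreeOne.{u} T) k).comp (FreeAlg.lift
          (.pi fun _ => FreeAlg.isModel T _) fun _ _ => FreeAlg.of T PUnit.unit) = Hom.id L _ :=
        FreeAlg.hom_ext fun _ => rfl
      exact fun x => ⟨x, DFunLike.congr_fun this x⟩ }⟩

end Solutions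

/-! ### Kleene algebras are separated by homomorphisms to the three-element chain -/

/-- In a bounded distributive lattice with an involution satisfying the Kleene axioms, distinct
elements are separated by a homomorphism to the three-element chain. -/
theorem exists_fin_three_separating {α : Type*} [DistribLattice α] [BoundedOrder α] (n : α → α)
    (hn : ∀ x, n (n x) = x) (hinf : ∀ x y, x ⊓ y = n (n x ⊔ n y))
    (hk : ∀ x y, x ⊓ n x ≤ y ⊔ n y) {x y : α} (hxy : ¬ x ≤ y) :
    ∃ φ : α → Fin 3, φ ⊥ = 0 ∧ φ ⊤ = 2 ∧ (∀ a, φ (n a) = (φ a).rev) ∧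
      (∀ a b, φ (a ⊓ b) = min (φ a) (φ b)) ∧ (∀ a b, φ (a ⊔ b) = max (φ a) (φ b)) ∧
      φ x ≠ φ y := by
  have hninf : ∀ a b, n (a ⊓ b) = n a ⊔ n b := fun a b => by rw [hinf, hn]
  have hnsup : ∀ a b, n (a ⊔ b) = n a ⊓ n b := fun a b => by rw [hinf, hn, hn]
  have hntop : n ⊤ = ⊥ := by
    have h := hninf ⊤ (n ⊥)
    rw [top_inf_eq, hn] at h
    exact le_bot_iff.1 (sup_eq_right.1 h.symm)
  have hnbot : n ⊥ = ⊤ := by rw [← hntop, hn]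
  -- A prime ideal containing `y` but not `x`. The value of `a` will be read off from whether `a`
  -- and `n a` lie in `J`.
  obtain ⟨J, hJ, hyJ, hxJ⟩ := DistribLattice.prime_ideal_of_disjoint_filter_ideal
    (F := Order.PFilter.principal x) (I := Order.Ideal.principal y)
    (Set.disjoint_left.2 fun a ha hb => hxy (le_trans (a := x) (b := a) ha hb))
  have hx : x ∉ J := Set.disjoint_left.1 hxJ (le_refl x)
  have hy : y ∈ J := hyJ (le_refl y)
  have hsup : ∀ a b, a ⊔ b ∈ J ↔ a ∈ J ∧ b ∈ J := fun a b => Order.Ideal.sup_mem_iff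
  have hinf' : ∀ a b, a ⊓ b ∈ J ↔ a ∈ J ∨ b ∈ J := fun a b =>
    ⟨hJ.mem_or_mem, fun h => h.elim (J.lower inf_le_left) (J.lower inf_le_right)⟩
  have hbot : ⊥ ∈ J := J.lower bot_le hy
  have htop : ⊤ ∉ J := fun h => hx (J.lower le_top h)
  -- The prime ideals `J` and `{a | n a ∉ J}` are comparable. Otherwise the Kleene inequality would
  -- put some `a ⊓ n a` in `J` with neither factor in `J`.
  have hcomp : (∀ a, a ∈ J ∨ n a ∈ J) ∨ ∀ a, ¬ (a ∈ J ∧ n a ∈ J) := by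
    by_contra! h
    obtain ⟨⟨a, ha, ha'⟩, b, hb, hb'⟩ := h
    exact ((hinf' _ _).not.2 (not_or.2 ⟨ha, ha'⟩)) (J.lower (hk a b) ((hsup _ _).2 ⟨hb, hb'⟩))
  classical
  -- The middle value stands both for "both in `J`" and for "neither in `J`". By comparability only
  -- one of these occurs, which the guards in `cmin` and `cmax` record; mixing the two would break
  -- preservation of meets and joins.
  let c : Bool → Bool → Fin 3 := fun p q => bif p then bif q then 1 else 0 else bif q then 2 else 1
  have cmin : ∀ p q p' q', ((p || q) ∧ (p' || q')) ∨ (¬ (p && q) ∧ ¬ (p' && q')) →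
      c (p || p') (q && q') = min (c p q) (c p' q') := by decide
  have cmax : ∀ p q p' q', ((p || q) ∧ (p' || q')) ∨ (¬ (p && q) ∧ ¬ (p' && q')) →
      c (p && p') (q || q') = max (c p q) (c p' q') := by decide
  have cne : ∀ q q' : Bool, (q ∨ ¬ q') → c false q ≠ c true q' := by decide
  have crev : ∀ p q, c q p = (c p q).rev := by decide
  have hcomp' : ∀ a b,
      ((decide (a ∈ J) || decide (n a ∈ J)) ∧ (decide (b ∈ J) || decide (n b ∈ J))) ∨
      (¬ (decide (a ∈ J) && decide (n a ∈ J)) ∧ ¬ (decide (b ∈ J) && decide (n b ∈ J))) := by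
    intro a b
    simp only [← Bool.decide_or, ← Bool.decide_and, decide_eq_true_eq]
    exact hcomp.imp (fun h => ⟨h a, h b⟩) fun h => ⟨h a, h b⟩
  refine ⟨fun a => c (decide (a ∈ J)) (decide (n a ∈ J)), ?_, ?_, fun a => ?_, fun a b => ?_,
    fun a b => ?_, ?_⟩
  · simp [hbot, hnbot, htop, c]
  · simp [hbot, hntop, htop, c]
  · simp only [hn]
    exact crev _ _
  · simp only [hinf', hninf, hsup, Bool.decide_or, Bool.decide_and]
    exact cmin _ _ _ _ (hcomp' a b)
  · simp only [hinf', hnsup, hsup, Bool.decide_or, Bool.decide_and]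
    exact cmax _ _ _ _ (hcomp' a b)
  · simp only [hx, hy, decide_true, decide_false]
    refine cne _ _ ?_
    simp only [decide_eq_true_eq]
    exact hcomp.imp (fun h => (h x).resolve_left hx) fun h h' => h y ⟨hy, h'⟩

namespace KleeneTerm

/-! The operations of a Kleene algebra. -/

section

universe v

variable {A : Type v} [kleeneLang.Structure A]

/-- The value of `0`. -/
def opBot (A : Type v) [kleeneLang.Structure A] : A :=
  Structure.funMap (L := kleeneLang) KleeneOp.bot ![]
/-- The value of `1`. -/
def opTop (A : Type v) [kleeneLang.Structure A] : A :=
  Structure.funMap (L := kleeneLang) KleeneOp.top ![]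
/-- The operation of negation. -/
def opNeg (a : A) : A := Structure.funMap (L := kleeneLang) KleeneOp.neg ![a]
/-- The operation of meet. -/
def opInf (a b : A) : A := Structure.funMap (L := kleeneLang) KleeneOp.inf ![a, b]
/-- The operation of join. -/
def opSup (a b : A) : A := Structure.funMap (L := kleeneLang) KleeneOp.sup ![a, b]

variable {X : Type u} (w : X → A) (s t : kleeneLang.Term X)

theorem realize_bot : (bot : kleeneLang.Term X).realize w = opBot A :=
  congrArg (Structure.funMap _) (Subsingleton.elim _ _)

theorem realize_top : (top : kleeneLang.Term X).realize w = opTop A :=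
  congrArg (Structure.funMap _) (Subsingleton.elim _ _)

theorem realize_neg : (neg s).realize w = opNeg (s.realize w) :=
  congrArg (Structure.funMap _) (funext fun i => by fin_cases i; rfl)

theorem realize_inf : (inf s t).realize w = opInf (s.realize w) (t.realize w) :=
  congrArg (Structure.funMap _) (funext fun i => by fin_cases i <;> rfl)

theorem realize_sup : (sup s t).realize w = opSup (s.realize w) (t.realize w) :=
  congrArg (Structure.funMap _) (funext fun i => by fin_cases i <;> rfl)

/-- A map that preserves the five operations is a homomorphism. -/
def homMk {B : Type*} [kleeneLang.Structure B] (φ : A → B) (hb : φ (opBot A) = opBot B)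
    (ht : φ (opTop A) = opTop B) (hn : ∀ a, φ (opNeg a) = opNeg (φ a))
    (hi : ∀ a b, φ (opInf a b) = opInf (φ a) (φ b))
    (hs : ∀ a b, φ (opSup a b) = opSup (φ a) (φ b)) : A →[kleeneLang] B where
  toFun := φ
  map_fun' {n} f x := by
    have h1 : ∀ x : Fin 1 → A, x = ![x 0] := fun x => funext fun i => by fin_cases i; rfl
    have h2 : ∀ x : Fin 2 → A, x = ![x 0, x 1] := fun x => funext fun i => by fin_cases i <;> rfl
    have h1' : ∀ x : Fin 1 → B, x = ![x 0] := fun x => funext fun i => by fin_cases i; rfl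
    have h2' : ∀ x : Fin 2 → B, x = ![x 0, x 1] := fun x => funext fun i => by
      fin_cases i <;> rfl
    change KleeneOp n at f
    cases f
    · rw [Subsingleton.elim x ![], Subsingleton.elim (φ ∘ _) ![] ]; exact hb
    · rw [Subsingleton.elim x ![], Subsingleton.elim (φ ∘ _) ![] ]; exact ht
    · rw [h1' (φ ∘ x), h1 x]; exact hn _
    · rw [h2' (φ ∘ x), h2 x]; exact hi _ _
    · rw [h2' (φ ∘ x), h2 x]; exact hs _ _
  map_rel' r _ _ := isEmptyElim r

end

end KleeneTerm

open KleeneTerm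

instance : DecidableEq K₃ := inferInstanceAs (DecidableEq (Fin 3))
instance : Fintype K₃ := inferInstanceAs (Fintype (Fin 3))
instance (k : ℕ) : OfNat K₃ k := inferInstanceAs (OfNat (Fin 3) k)

theorem kleeneTheory.exists_hom_ne {A : Type u} [kleeneLang.Structure A]
    (hA : IsModel kleeneTheory A) {a b : A} (hab : a ≠ b) :
    ∃ φ : A →[kleeneLang] K₃, φ a ≠ φ b := by
  have key : ∀ e ∈ kleeneTheory, ∀ p q r : A,
      e.1.realize (fun i => if i = 0 then p else if i = 1 then q else r) =
      e.2.realize (fun i => if i = 0 then p else if i = 1 then q else r) :=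
    fun e he p q r => hA e he _
  simp only [kleeneTheory, Set.mem_insert_iff, Set.mem_singleton_iff, forall_eq_or_imp, forall_eq,
    realize_inf, realize_sup, realize_neg, realize_bot, realize_top, x, y, z, Term.realize_var,
    if_true, OfNat.ofNat_ne_zero, OfNat.ofNat_ne_one, one_ne_zero, if_false] at key
  obtain ⟨ic, sc, ia, sa, is, si, di, sb, it, nn, dm, kl⟩ := key
  let _ : Max A := ⟨opSup⟩
  let _ : Min A := ⟨opInf⟩
  let l : Lattice A := Lattice.mk' (fun a b => sc a b a) sa (fun a b => ic a b a) ia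
    (fun a b => si a b a) (fun a b => is a b a)
  let d : DistribLattice A := .ofInfSupLe fun a b c => (di a b c).le
  let _ : BoundedOrder A :=
    { bot := opBot A
      top := opTop A
      bot_le := fun a => sup_eq_left.1 (sb a a a)
      le_top := fun a => inf_eq_left.1 (it a a a) }
  -- Separation is stated for `¬ x ≤ y`, which holds for distinct elements in at least one of the
  -- two orders.
  have hne : ∃ φ : A →[kleeneLang] K₃, ∃ x y, ((x = a ∧ y = b) ∨ (x = b ∧ y = a)) ∧ φ x ≠ φ y := by
    have : ∃ x y, ((x = a ∧ y = b) ∨ (x = b ∧ y = a)) ∧ ¬ x ≤ y := by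
      by_cases h : a ≤ b
      · exact ⟨b, a, .inr ⟨rfl, rfl⟩, fun h' => hab (le_antisymm h h')⟩
      · exact ⟨a, b, .inl ⟨rfl, rfl⟩, h⟩
    obtain ⟨x, y, h, hxy⟩ := this
    obtain ⟨φ, hb, ht, hn, hi, hs, hφ⟩ := exists_fin_three_separating opNeg
      (fun a => nn a a a) (fun a b => dm a b a) (fun a b => inf_eq_left.1 (kl a b a)) hxy
    exact ⟨homMk φ hb ht hn hi hs, x, y, h, hφ⟩
  obtain ⟨φ, x, y, ⟨rfl, rfl⟩ | ⟨rfl, rfl⟩, h⟩ := hne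
  exacts [⟨φ, h⟩, ⟨φ, h.symm⟩]

theorem kleeneTheory_subset : kleeneTheory ⊆ kleeneLogicTheory := by
  intro e he v
  simp only [kleeneTheory, Set.mem_insert_iff, Set.mem_singleton_iff] at he
  rcases he with rfl | rfl | rfl | rfl | rfl | rfl | rfl | rfl | rfl | rfl | rfl | rfl <;>
  simp only [realize_inf, realize_sup, realize_neg, realize_bot, realize_top, x, y, z,
    Term.realize_var] <;>
  generalize v 0 = p <;> generalize v 1 = q <;> generalize v 2 = r <;> revert p q r <;> decide

/-! ### Terms over the three-element chain -/

section ThreeValued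

variable {X : Type u}

/-- Terms are monotone in the information order, in which `a` lies below `0` and `1`. -/
theorem realize_info_mono (t : kleeneLang.Term X) {v w : X → K₃}
    (h : ∀ x, v x = 1 ∨ v x = w x) : t.realize v = 1 ∨ t.realize v = t.realize w := by
  induction t with
  | var x => exact h x
  | @func l f ts ih =>
    change KleeneOp l at f
    have inf' : ∀ p q p' q' : K₃, p = 1 ∨ p = p' → q = 1 ∨ q = q' →
      opInf p q = 1 ∨ opInf p q = opInf p' q' := by decide
    have sup' : ∀ p q p' q' : K₃, p = 1 ∨ p = p' → q = 1 ∨ q = q' →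
      opSup p q = 1 ∨ opSup p q = opSup p' q' := by decide
    have neg' : ∀ p p' : K₃, p = 1 ∨ p = p' → opNeg p = 1 ∨ opNeg p = opNeg p' := by decide
    cases f
    · exact .inr rfl
    · exact .inr rfl
    · exact neg' _ _ (ih 0)
    · exact inf' _ _ _ _ (ih 0) (ih 1)
    · exact sup' _ _ _ _ (ih 0) (ih 1)

/-- Terms take classical values at classical valuations. -/
theorem realize_ne_one (t : kleeneLang.Term X) {v : X → K₃} (h : ∀ x, v x ≠ 1) :
    t.realize v ≠ 1 := by
  induction t with
  | var x => exact h x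
  | @func l f ts ih =>
    change KleeneOp l at f
    have inf' : ∀ p q : K₃, p ≠ 1 → q ≠ 1 → opInf p q ≠ 1 := by decide
    have sup' : ∀ p q : K₃, p ≠ 1 → q ≠ 1 → opSup p q ≠ 1 := by decide
    have neg' : ∀ p : K₃, p ≠ 1 → opNeg p ≠ 1 := by decide
    cases f
    · exact (by decide : (0 : K₃) ≠ 1)
    · exact (by decide : (2 : K₃) ≠ 1)
    · exact neg' _ (ih 0)
    · exact inf' _ _ (ih 0) (ih 1)
    · exact sup' _ _ (ih 0) (ih 1)

/-- A classical value of a term is taken at a classical valuation. -/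
theorem exists_classical_valuation (t : kleeneLang.Term X) {v : X → K₃} (h : t.realize v ≠ 1) :
    ∃ c : X → K₃, (∀ x, c x ≠ 1) ∧ t.realize c = t.realize v := by
  -- Undetermined variables are set to 0, an arbitrary choice: this only adds information, so a
  -- classical value is kept.
  refine ⟨fun x => if v x = 1 then 0 else v x, fun x => ?_, ?_⟩
  · by_cases hx : v x = 1
    · simp only [hx, if_true]; decide
    · simp [hx]
  · refine ((realize_info_mono t fun x => ?_).resolve_left h).symm
    by_cases hx : v x = 1
    · exact .inl hx
    · simp [hx]

/-- A term with different values is undetermined at the valuation that is constantly `a`. -/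
theorem realize_const_one (t : kleeneLang.Term X) {v w : X → K₃}
    (h : t.realize v ≠ t.realize w) : t.realize (fun _ => (1 : K₃)) = 1 :=
  (realize_info_mono t fun _ => .inl rfl).elim id fun hv =>
    (realize_info_mono t fun _ => .inl rfl).elim id fun hw => absurd (hv.symm.trans hw) h

/-- A term in one variable with prescribed classical values at `0` and at `1`. -/
def interpTerm (c d : K₃) (y : X) : kleeneLang.Term X :=
  if c = 0 then if d = 0 then inf (.var y) (neg (.var y)) else .var y
  else if d = 0 then neg (.var y) else sup (.var y) (neg (.var y))

theorem realize_interpTerm {c d : K₃} (hc : c ≠ 1) (hd : d ≠ 1) (y : X) (v : X → K₃) :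
    (interpTerm c d y).realize v = if v y = 0 then c else if v y = 1 then 1 else d := by
  have : (interpTerm c d y).realize v =
      if c = 0 then if d = 0 then opInf (v y) (opNeg (v y)) else v y
      else if d = 0 then opNeg (v y) else opSup (v y) (opNeg (v y)) := by
    unfold interpTerm
    split_ifs <;> simp only [realize_inf, realize_sup, realize_neg, Term.realize_var]
  rw [this]
  clear this
  generalize v y = p
  revert c d p
  decide

open Classical in
/-- The canonical term in one variable for a set of truth values. -/
noncomputable def canonTerm (S : Set K₃) (y : X) : kleeneLang.Term X :=
  if 0 ∈ S then
    -- Whether `1 ∈ S` is irrelevant here: a term with both classical values also takes the value 1.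
    if 2 ∈ S then .var y else if 1 ∈ S then inf (.var y) (neg (.var y)) else bot
  else if 1 ∈ S then sup (.var y) (neg (.var y)) else top

theorem realize_canonTerm_of_mem {S : Set K₃} (y : X) {v : X → K₃} (h : v y ∈ S) :
    (canonTerm S y).realize v = v y := by
  have h3 : ∀ p : K₃, p = 0 ∨ p = 1 ∨ p = 2 := by decide
  unfold canonTerm
  rcases h3 (v y) with hp | hp | hp <;> rw [hp] at h <;> split_ifs <;>
    first
    | contradiction
    | (simp only [realize_inf, realize_sup, realize_neg, realize_bot, realize_top,
        Term.realize_var, hp] <;> decide)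

theorem realize_canonTerm_idem (S : Set K₃) (y : X) (v : X → K₃) :
    (canonTerm S y).realize (fun _ => (canonTerm S y).realize v) = (canonTerm S y).realize v := by
  unfold canonTerm
  split_ifs <;> simp only [realize_inf, realize_sup, realize_neg, realize_bot, realize_top,
        Term.realize_var] <;> generalize v y = p <;> revert p <;> decide

end ThreeValued

/-! ### Theories between Kleene algebras and three-valued Kleene logic -/

section Values

/-- The truth values of an element under the homomorphisms to the three-element chain. -/
def values {A : Type u} [kleeneLang.Structure A] (a : A) : Set K₃ :=
  {k | ∃ φ : A →[kleeneLang] K₃, φ a = k}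

theorem values_hom_subset {A B : Type u} [kleeneLang.Structure A] [kleeneLang.Structure B]
    (f : A →[kleeneLang] B) (a : A) : values (f a) ⊆ values a := by
  rintro _ ⟨φ, rfl⟩
  exact ⟨φ.comp f, rfl⟩

variable {T : EqTheory kleeneLang} {X Y : Type u}

/-- Reduces every equation below to a check in `K₃`. -/
theorem hom_separating (hT : kleeneTheory ⊆ T) {A : Type u} [kleeneLang.Structure A]
    (hA : IsModel T A) {a b : A} (h : ∀ φ : A →[kleeneLang] K₃, φ a = φ b) : a = b := by
  by_contra hab
  obtain ⟨φ, hφ⟩ := kleeneTheory.exists_hom_ne (fun e he => hA e (hT he)) hab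
  exact hφ (h φ)

/-- The homomorphism from the free algebra to the three-element chain given by a valuation. -/
def valuationHom (hT : T ⊆ kleeneLogicTheory) (v : X → K₃) : FreeAlg T X →[kleeneLang] K₃ :=
  -- The power of `K₃` over a one-point type moves it into universe `u`, where the free algebra is
  -- universal.
  (piEval (fun _ : PUnit.{u + 1} => K₃) PUnit.unit).comp
    (FreeAlg.lift (.pi fun _ _ he => hT he) fun x _ => v x)

theorem valuationHom_mk (hT : T ⊆ kleeneLogicTheory) (v : X → K₃) (t : kleeneLang.Term X) :
    valuationHom hT v (FreeAlg.mk T t) = t.realize v :=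
  FreeAlg.hom_mk _ t

/-- An element of a free algebra taking all values in `S` has the canonical term for `S` as a
specialization. -/
theorem exists_hom_to_canonTerm (hT : kleeneTheory ⊆ T)
    {S : Set K₃} (hS : 0 ∈ S ∨ 2 ∈ S) (y : Y) (t : FreeAlg T X) (ht : S ⊆ values t) :
    ∃ σ : FreeAlg T X →[kleeneLang] FreeAlg T Y, σ t = FreeAlg.mk T (canonTerm S y) := by
  obtain ⟨t, rfl⟩ := (termCong T X).mkHom_surjective t
  have classical : ∀ k ∈ S, k ≠ 1 → ∃ c : X → K₃, (∀ x, c x ≠ 1) ∧ t.realize c = k := by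
    intro k hk hk1
    obtain ⟨φ, rfl⟩ := ht hk
    rw [FreeAlg.hom_mk] at hk1 ⊢
    exact exists_classical_valuation t hk1
  -- Each variable `x` is replaced by a term in `y` with value `c x`, 1, `d x` at `y = 0, 1, 2`. The
  -- result takes at these points the values of `t` at `c`, at the undetermined valuation and at
  -- `d`.
  have interp : ∀ c d : X → K₃, (∀ x, c x ≠ 1) → (∀ x, d x ≠ 1) →
      (∀ v : Y → K₃, (canonTerm S y).realize v =
        if v y = 0 then t.realize c else if v y = 1 then t.realize (fun _ => (1 : K₃))
        else t.realize d) →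
      ∃ σ : FreeAlg T X →[kleeneLang] FreeAlg T Y,
        σ (FreeAlg.mk T t) = FreeAlg.mk T (canonTerm S y) := by
    intro c d hc hd h
    refine ⟨FreeAlg.lift (FreeAlg.isModel T Y) fun x => FreeAlg.mk T (interpTerm (c x) (d x) y),
      hom_separating hT (FreeAlg.isModel T Y) fun φ => ?_⟩
    have hφ : (φ ∘ fun x => FreeAlg.mk T (interpTerm (c x) (d x) y)) = fun x =>
        if φ (FreeAlg.of T y) = 0 then c x else if φ (FreeAlg.of T y) = 1 then 1 else d x :=
      funext fun x => (FreeAlg.hom_mk φ _).trans (realize_interpTerm (hc x) (hd x) y _)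
    rw [FreeAlg.lift_mk, ← HomClass.realize_term, FreeAlg.hom_mk, h, hφ]
    split_ifs <;> rfl
  have undetermined : 1 ∈ S → ∀ c : X → K₃, t.realize c ≠ 1 →
      t.realize (fun _ => (1 : K₃)) = 1 := by
    intro h c hc
    obtain ⟨φ, hφ⟩ := ht h
    rw [FreeAlg.hom_mk] at hφ
    exact realize_const_one t (v := c) (by rw [hφ]; exact hc)
  have constant : ∀ (c : X → K₃) (s : kleeneLang.Term Y), (∀ x, c x ≠ 1) →
      (∀ v : Y → K₃, s.realize v = t.realize c) →
      ∃ σ : FreeAlg T X →[kleeneLang] FreeAlg T Y, σ (FreeAlg.mk T t) = FreeAlg.mk T s := by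
    intro c s hc h
    refine ⟨FreeAlg.lift (FreeAlg.isModel T Y) fun x => FreeAlg.mk T (if c x = 0 then bot else top),
      hom_separating hT (FreeAlg.isModel T Y) fun φ => ?_⟩
    rw [FreeAlg.lift_mk, ← HomClass.realize_term, FreeAlg.hom_mk, h]
    congr 1
    funext x
    have hx : c x = 0 ∨ c x = 2 := by
      have := hc x
      generalize c x = k at *
      revert k; decide
    refine (FreeAlg.hom_mk φ _).trans ?_
    rcases hx with hx | hx <;> rw [hx]
    · exact realize_bot _
    · exact realize_top _
  have h02 : (0 : K₃) ≠ 2 := by decide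
  have h01 : (0 : K₃) ≠ 1 := by decide
  have h21 : (2 : K₃) ≠ 1 := by decide
  by_cases h0 : (0 : K₃) ∈ S
  · obtain ⟨c, hc, hc0⟩ := classical 0 h0 h01
    by_cases h2 : (2 : K₃) ∈ S
    · obtain ⟨d, hd, hd2⟩ := classical 2 h2 h21
      refine interp c d hc hd fun v => ?_
      rw [hc0, hd2, realize_const_one t (v := c) (w := d) (by rw [hc0, hd2]; exact h02)]
      simp only [canonTerm, h0, h2, if_true, Term.realize_var]
      generalize v y = p
      revert p; decide
    · by_cases h1 : (1 : K₃) ∈ S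
      -- With one classical value available, the same valuation serves at both ends.
      · refine interp c c hc hc fun v => ?_
        rw [hc0, undetermined h1 c (by rw [hc0]; exact h01)]
        simp only [canonTerm, h0, h1, h2, if_true, if_false, realize_inf, realize_neg,
          Term.realize_var]
        generalize v y = p
        revert p; decide
      · refine constant c _ hc fun v => ?_
        simp only [canonTerm, h0, h1, h2, if_true, if_false, realize_bot, hc0]
        rfl
  · have h2 := hS.resolve_left h0
    obtain ⟨d, hd, hd2⟩ := classical 2 h2 h21
    by_cases h1 : (1 : K₃) ∈ S
    · refine interp d d hd hd fun v => ?_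
      rw [hd2, undetermined h1 d (by rw [hd2]; exact h21)]
      simp only [canonTerm, h0, h1, if_true, if_false, realize_sup, realize_neg,
        Term.realize_var]
      generalize v y = p
      revert p; decide
    · refine constant d _ hd fun v => ?_
      simp only [canonTerm, h0, h1, if_false, realize_top, hd2]
      rfl

/-- Every element with all values in `S` is a specialization of the canonical term for `S`. -/
theorem lift_canonTerm (hT : kleeneTheory ⊆ T) {A : Type u} [kleeneLang.Structure A]
    (hA : IsModel T A) {S : Set K₃} (y : Y) {a : A} (ha : values a ⊆ S) :
    FreeAlg.lift hA (fun _ : Y => a) (FreeAlg.mk T (canonTerm S y)) = a := by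
  refine hom_separating hT hA fun φ => ?_
  rw [FreeAlg.lift_mk, ← HomClass.realize_term]
  exact realize_canonTerm_of_mem (v := fun _ => φ a) y (ha ⟨φ, rfl⟩)

/-- Idempotence is what later makes the kernel of this endomorphism a projective congruence. -/
theorem lift_canonTerm_idem (hT : kleeneTheory ⊆ T) (S : Set K₃) (y : Y) :
    FreeAlg.lift (FreeAlg.isModel T Y) (fun _ : Y => FreeAlg.mk T (canonTerm S y))
      (FreeAlg.mk T (canonTerm S y)) = FreeAlg.mk T (canonTerm S y) := by
  refine hom_separating hT (FreeAlg.isModel T Y) fun φ => ?_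
  rw [FreeAlg.lift_mk, ← HomClass.realize_term, Function.comp_def, FreeAlg.hom_mk]
  exact realize_canonTerm_idem S y _

/-- Elements of free algebras have classical values. -/
theorem FreeAlg.values_classical (hT : T ⊆ kleeneLogicTheory) (t : FreeAlg T X) :
    0 ∈ values t ∨ 2 ∈ values t := by
  obtain ⟨t, rfl⟩ := (termCong T X).mkHom_surjective t
  have h1 : t.realize (fun _ => (0 : K₃)) ≠ 1 := realize_ne_one t fun _ => by decide
  have h3 : ∀ p : K₃, p ≠ 1 → p = 0 ∨ p = 2 := by decide
  exact (h3 _ h1).imp (fun h => ⟨valuationHom hT fun _ => 0, (valuationHom_mk _ _ _).trans h⟩)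
    fun h => ⟨valuationHom hT fun _ => 0, (valuationHom_mk _ _ _).trans h⟩

theorem values_classical_of_hom (hT : T ⊆ kleeneLogicTheory) {A : Type u} [kleeneLang.Structure A]
    (f : A →[kleeneLang] FreeAlg T X) (a : A) : 0 ∈ values a ∨ 2 ∈ values a :=
  (FreeAlg.values_classical hT (f a)).imp (fun h => values_hom_subset f a h)
    fun h => values_hom_subset f a h

end Values

/-! ### Least solutions of symbolic and algebraic problems -/

section Types

variable {T : EqTheory kleeneLang}

/-- The canonical term for the union of the value sets of the given terms is a least general
solution. The two inclusions on `T` cover Kleene algebras and Kleene logic at once. -/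
theorem hasSymbolicType_unitary (hT : kleeneTheory ⊆ T) (hT' : T ⊆ kleeneLogicTheory) :
    HasSymbolicType T .unitary := by
  refine isLeast_unitary fun p => ?_
  set S : Set K₃ := {k | ∃ a ∈ p.1, k ∈ values a}
  have hS : 0 ∈ S ∨ 2 ∈ S := by
    obtain ⟨a, ha⟩ := Multiset.exists_mem_of_ne_zero p.2
    exact (FreeAlg.values_classical hT' a).imp (fun h => ⟨a, ha, h⟩) fun h => ⟨a, ha, h⟩
  refine preorderType_eq_unitary (P := SymSolution p) ⟨FreeAlg.mk T (canonTerm S 0), fun a ha =>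
    ⟨_, lift_canonTerm hT (FreeAlg.isModel T ℕ) 0 fun k hk => ⟨a, ha, hk⟩⟩⟩ fun s => ?_
  refine exists_hom_to_canonTerm hT hS 0 s.1 ?_
  rintro k ⟨a, ha, hk⟩
  obtain ⟨σ, rfl⟩ := s.2 a ha
  exact values_hom_subset σ s.1 hk

/-- Every algebraic problem has an idempotent endomorphism of `F(z)` as its least solution. -/
theorem exists_least_algSolution (hT : kleeneTheory ⊆ T) (hT' : T ⊆ kleeneLogicTheory)
    (p : AlgProblem.{u} T) : ∃ g : FreeOne.{u} T →[kleeneLang] FreeOne.{u} T,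
      (∀ x, g (g x) = g x) ∧
      (∃ f : FreeOne.{u} T →[kleeneLang] (∀ k, p.E k), f.comp g = p.h) ∧
      ∀ s : AlgSolution p, ∃ f : s.P →[kleeneLang] FreeOne.{u} T, f.comp s.g = g := by
  set z : FreeOne.{u} T := FreeAlg.of T PUnit.unit
  -- The values are those of `p.h z` in the whole product, not only those coming from single
  -- factors, so it is treated as one element of one model.
  set S := values (p.h z)
  have hS : 0 ∈ S ∨ 2 ∈ S := by
    -- Since `m ≥ 1`, a projection followed by an embedding maps the product into a free algebra,
    -- where elements have a classical value.
    obtain ⟨X, ι, -⟩ := (p.exact ⟨0, p.one_le⟩).exists_injective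
    exact values_classical_of_hom hT' (ι.comp (piEval p.E _)) _
  refine ⟨FreeAlg.lift (FreeAlg.isModel T _) fun _ => FreeAlg.mk T (canonTerm S PUnit.unit),
    fun x => ?_, ⟨FreeAlg.lift (.pi fun k => (p.exact k).isModel) fun _ => p.h z, ?_⟩,
    fun s => ?_⟩
  · rw [← Hom.comp_apply]
    congr 1
    exact FreeAlg.hom_ext fun _ => lift_canonTerm_idem hT S PUnit.unit
  · exact FreeAlg.hom_ext fun _ =>
      lift_canonTerm hT (.pi fun k => (p.exact k).isModel) _ subset_rfl
  · obtain ⟨f, hf⟩ := s.factors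
    obtain ⟨r, hr⟩ := s.projective.exists_section
    -- The section `r` moves `s.g z` into a free algebra, and this image still maps onto `p.h z`, so
    -- no value in `S` is lost.
    have hle : S ⊆ values (r (s.g z)) := by
      have : f.comp (FreeAlg.lift s.projective.1 id) (r (s.g z)) = p.h z := by
        rw [Hom.comp_apply, hr, ← hf, Hom.comp_apply]
      rw [show S = values (p.h z) from rfl, ← this]
      exact values_hom_subset _ _
    obtain ⟨σ, hσ⟩ := exists_hom_to_canonTerm hT hS PUnit.unit _ hle
    exact ⟨σ.comp r, FreeAlg.hom_ext fun _ => hσ⟩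

theorem hasAlgebraicType_unitary (hT : kleeneTheory ⊆ T) (hT' : T ⊆ kleeneLogicTheory) :
    HasAlgebraicType.{u} T .unitary := by
  refine isLeast_unitary fun p => ?_
  obtain ⟨g, -, hf, hleast⟩ := exists_least_algSolution hT hT' p
  exact preorderType_eq_unitary (P := AlgSolution p)
    { P := FreeOne.{u} T, fg := FreeAlg.fg, projective := FreeAlg.isProjective T _, g := g,
      factors := hf } hleast

end Types

theorem mainTheorem11 :
    (HasSymbolicType kleeneTheory GenType.unitary ∧
      HasAlgebraicType.{u} kleeneTheory GenType.unitary) ∧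
    (HasSymbolicType kleeneLogicTheory GenType.unitary ∧
      HasAlgebraicType.{u} kleeneLogicTheory GenType.unitary) ∧
    (∀ θ : Cong kleeneLang (FreeOne.{u} kleeneTheory), IsECong kleeneTheory θ →
      ∃ π, IsGreatest {π | IsProjectiveCong kleeneTheory π ∧ π ≤ θ} π) := by
  refine ⟨⟨hasSymbolicType_unitary subset_rfl kleeneTheory_subset,
    hasAlgebraicType_unitary subset_rfl kleeneTheory_subset⟩,
    ⟨hasSymbolicType_unitary kleeneTheory_subset subset_rfl,
    hasAlgebraicType_unitary kleeneTheory_subset subset_rfl⟩, ?_⟩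
  rintro _ ⟨p, rfl⟩
  obtain ⟨g, hg, hf, hleast⟩ := exists_least_algSolution subset_rfl kleeneTheory_subset p
  exact ⟨_, isGreatest_ker g hg hf hleast⟩
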